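/- Assume Schanuel's Conjecture: whenever $\lambda_1,\dots,\lambda_m\in\mathbb C$ are linearly independent over $\mathbb Q$, the field $\mathbb Q(\lambda_1,\dots,\lambda_m,e^{\lambda_1},\dots,e^{\lambda_m})$ has transcendence degree at least $m$ over $\mathbb Q$. A cone is an open set $U\subseteq\mathbb C^n$ such that $t\bar x\in U$ for all $\bar x\in U$ and all real $t\ge 1$. For a subfield $K\subseteq\mathbb C$, an algebraic function over $K(\bar x)$ on $U$ is an analytic function $f:U\to\mathbb C$ such that $p(\bar x,f(\bar x))=0$ on $U$ for some nonzero polynomial $p\in K[\bar x,u]$; it is called nonzero if it does not vanish identically on any connected component of $U$ (for connected $U$: if it is not identically zero). It is homogeneous of degree $r\in\mathbb Q$ if $f(t\bar x)=t^rf(\bar x)$ for all $\bar x\in U$ and real $t\ge1$. We say that $f$ has degree $r\in\mathbb Q$ on $U$, $\deg f=r$, if there is a nonzero algebraic function $h$ over $\mathbb C(\bar x)$ on $U$, homogeneous of degree $r$, such that for every $\bar x\in U$ one has $f(t\bar x)-h(t\bar x)=o(t^r)$ as $t\to+\infty$, $t$ real. On a nonempty cone there is at most one such $r$. Let $n\ge2$,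 let $U\subseteq\mathbb C^n$ be a cone such that $U\cap(2\pi i\,\mathbb Z^*)^n$ is Zariski dense in $\mathbb C^n$, where $\mathbb Z^*=\mathbb Z\setminus\{0\}$, and let $f_1,\dots,f_n$ be nonzero algebraic functions over $\mathbb Q(x_1,\dots,x_n)$ on $U$. Suppose that $f_1$ has a degree $\deg f_1$ and that $\deg f_1\neq0$. Then there is $\bar a=(a_1,\dots,a_n)\in U$ such that $e^{a_i}=f_i(\bar a)$ for $i=1,\dots,n$ and such that $\mathbb Q(a_1,\dots,a_n)$ has transcendence degree at least $2$ over $\mathbb Q$. -/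

import Mathlib

namespace ExpAlg

open Filter Asymptotics

/-- Schanuel's conjecture: if `l₁, …, lₘ` are complex numbers linearly independent over `ℚ`, then
`ℚ(l₁, …, lₘ, e^{l₁}, …, e^{lₘ})` has transcendence degree at least `m` over `ℚ`. -/
def SchanuelConjecture : Prop :=
  ∀ (m : ℕ) (l : Fin m → ℂ), LinearIndependent ℚ l →
    (m : Cardinal) ≤ Algebra.trdeg ℚ
      (IntermediateField.adjoin ℚ (Set.range l ∪ Set.range fun i => Complex.exp (l i)))

/-- A cone (at infinity): an open subset of `ℂⁿ` stable under multiplication by reals `t ≥ 1`. -/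
def IsCone {n : ℕ} (U : Set (Fin n → ℂ)) : Prop :=
  IsOpen U ∧ ∀ t : ℝ, 1 ≤ t → ∀ x ∈ U, t • x ∈ U

/-- `f` is an algebraic function over `K(x₁, …, xₙ)` on `U`: it is analytic at the points of `U`,
and `p(x, f(x)) = 0` on `U` for some nonzero polynomial `p ∈ K[x₁, …, xₙ][u]`. -/
def IsAlgebraicFunction {n : ℕ} (K : Type) [Field K] [Algebra K ℂ]
    (U : Set (Fin n → ℂ)) (f : (Fin n → ℂ) → ℂ) : Prop :=
  AnalyticOnNhd ℂ f U ∧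
    ∃ p : Polynomial (MvPolynomial (Fin n) K), p ≠ 0 ∧
      ∀ x ∈ U, Polynomial.eval₂ (MvPolynomial.aeval x : MvPolynomial (Fin n) K →ₐ[K] ℂ).toRingHom
        (f x) p = 0

/-- `f` is nonzero on `U`: it does not vanish identically on any connected component of `U`.
For connected nonempty `U` this says that `f` is not identically zero on `U`. -/
def NonzeroOn {n : ℕ} (U : Set (Fin n → ℂ)) (f : (Fin n → ℂ) → ℂ) : Prop :=
  ∀ x ∈ U, ∃ y ∈ connectedComponentIn U x, f y ≠ 0

/-- `h` is homogeneous of degree `r` on `U`: `h(t x) = t ^ r h(x)` for `x ∈ U` and real `t ≥ 1`. -/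
def IsHomogeneousFunction {n : ℕ} (U : Set (Fin n → ℂ)) (h : (Fin n → ℂ) → ℂ) (r : ℚ) : Prop :=
  ∀ x ∈ U, ∀ t : ℝ, 1 ≤ t → h (t • x) = ((t ^ (r : ℝ) : ℝ) : ℂ) * h x

/-- `f` has degree `r` on the cone `U`: there is a nonzero algebraic function `h` on `U`,
homogeneous of degree `r`, which is the leading term of `f` at infinity:
`f - h = o(|x| ^ r)` along each ray `{t x : t ≥ 1}` in `U`. -/
def HasDegree {n : ℕ} (U : Set (Fin n → ℂ)) (f : (Fin n → ℂ) → ℂ) (r : ℚ) : Prop :=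
  ∃ h : (Fin n → ℂ) → ℂ, IsAlgebraicFunction ℂ U h ∧ NonzeroOn U h ∧
    IsHomogeneousFunction U h r ∧
    ∀ x ∈ U, (fun t : ℝ => f (t • x) - h (t • x)) =o[atTop] fun t : ℝ => t ^ (r : ℝ)

/-- `S` is Zariski dense in `ℂⁿ`. -/
def IsZariskiDense {n : ℕ} (S : Set (Fin n → ℂ)) : Prop :=
  ∀ p : MvPolynomial (Fin n) ℂ, (∀ x ∈ S, MvPolynomial.eval x p = 0) → p = 0

/-- The set `(2πi ℤ*)ⁿ`, where `ℤ*` is the set of nonzero integers. -/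
def lattice (n : ℕ) : Set (Fin n → ℂ) :=
  {x | ∀ i, ∃ k : ℤ, k ≠ 0 ∧ x i = 2 * (Real.pi : ℂ) * Complex.I * (k : ℂ)}

end ExpAlg

namespace ExpAlg

open Filter Asymptotics Topology

/-! ### Algebraic functions grow at most polynomially near a generic ray -/

section Growth

variable {n : ℕ} {K : Type} [Field K] [Algebra K ℂ]

/-! Pick a lattice point `y ∈ U` off a suitable hypersurface. Since `exp (N y i) = 1`, solutions are
sought near `N y`. Algebraicity gives `|log ‖f i‖| ≤ M log N` on a ball of radius proportional to
`N` around `N y` (`eventually_abs_log_norm_le`). By Borel–Carathéodory, `log (f i)` is then nearly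
constant at distance `O(log N)` from the centre, and the contraction principle gives a solution `a
N` at distance `O(log N)` from `N y` (`exists_exp_eq_near`, `eventually_exists_solution`).

If all these fields had transcendence degree below `2`, Schanuel's conjecture would force the first
two coordinates of `a N` to be rationally dependent, the `exp (a N i)` being algebraic over `ℚ(a N)`
(`two_le_trdeg_adjoin`). Their ratio is rational, hence real. Imaginary parts, of size `N`, show
that it tends to `k1 / k0`, the ratio of the coordinates of `y`. Real parts, of scale `log N`, are
the `log ‖f i (N y)‖` up to `O(1)`. So the second function has growth exponent `(k1 / k0) r` along
`y`, where `r` is the degree of the first (`tendsto_exponent_of_dependent`).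

By a Newton polygon argument such an exponent lies in a finite set that does not depend on `y`
(`exponent_mem_slopes`). As `r ≠ 0`, this confines `y` to finitely many hyperplanes, which a Zariski
dense set of choices avoids. -/

theorem analyticOnNhd_eval₂ {U : Set (Fin n → ℂ)} {f : (Fin n → ℂ) → ℂ}
    (hf : AnalyticOnNhd ℂ f U) (p : Polynomial (MvPolynomial (Fin n) K)) :
    AnalyticOnNhd ℂ (fun x => Polynomial.eval₂
      (MvPolynomial.aeval x : MvPolynomial (Fin n) K →ₐ[K] ℂ).toRingHom (f x) p) U := by
  simp only [Polynomial.eval₂_eq_sum_range]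
  refine Finset.analyticOnNhd_fun_sum _ fun i _ => AnalyticOnNhd.mul ?_ (hf.pow i)
  exact AnalyticOnNhd.aeval_mvPolynomial
    (fun j x _ => (ContinuousLinearMap.proj (R := ℂ) (φ := fun _ : Fin n => ℂ) j).analyticAt x) _

/-- A nonzero algebraic function satisfies a polynomial equation with nonzero constant term. -/
theorem exists_coeff_zero_ne_zero {U : Set (Fin n → ℂ)} (hU : IsOpen U) {f : (Fin n → ℂ) → ℂ}
    (hf : IsAlgebraicFunction K U f) (hnz : NonzeroOn U f) :
    ∃ p : Polynomial (MvPolynomial (Fin n) K), p.coeff 0 ≠ 0 ∧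
      ∀ x ∈ U, Polynomial.eval₂ (MvPolynomial.aeval x : MvPolynomial (Fin n) K →ₐ[K] ℂ).toRingHom
        (f x) p = 0 := by
  obtain ⟨hfa, p, hp0, hp⟩ := hf
  induction hd : p.natDegree using Nat.strong_induction_on generalizing p with
  | _ d ih =>
    by_cases h0 : p.coeff 0 = 0
    · have hX : Polynomial.X * p.divX = p := by
        have := p.X_mul_divX_add
        rwa [h0, map_zero, add_zero] at this
      have hdiv0 : p.divX ≠ 0 := by
        intro h; rw [h, mul_zero] at hX; exact hp0 hX.symm
      have hdeg : p.divX.natDegree < d := by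
        have h1 := Polynomial.natDegree_X_mul hdiv0
        rw [hX, hd] at h1
        omega
      refine ih _ hdeg _ hdiv0 (fun x hx => ?_) rfl
      set q := fun x : Fin n → ℂ => Polynomial.eval₂
        (MvPolynomial.aeval x : MvPolynomial (Fin n) K →ₐ[K] ℂ).toRingHom (f x) p.divX with hq
      have hmul : ∀ z ∈ U, f z * q z = 0 := by
        intro z hz
        have := hp z hz
        rw [← hX, Polynomial.eval₂_mul, Polynomial.eval₂_X] at this
        exact this
      -- The cofactor vanishes near a point of the component where `f ≠ 0`, so the identity theorem
      -- kills it on the whole component.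
      obtain ⟨y, hy, hfy⟩ := hnz x hx
      have hsub := connectedComponentIn_subset U x
      have hqa : AnalyticOnNhd ℂ q (connectedComponentIn U x) :=
        (analyticOnNhd_eval₂ hfa _).mono hsub
      have hev : q =ᶠ[𝓝 y] 0 := by
        have h1 : ∀ᶠ z in 𝓝 y, f z ≠ 0 := (hfa y (hsub hy)).continuousAt.eventually_ne hfy
        filter_upwards [h1, hU.mem_nhds (hsub hy)] with z hz hzU
        exact (mul_eq_zero.mp (hmul z hzU)).resolve_left hz
      exact hqa.eqOn_zero_of_preconnected_of_eventuallyEq_zero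
        isPreconnected_connectedComponentIn hy hev (mem_connectedComponentIn hx)
    · exact ⟨p, h0, hp⟩

theorem aeval_smul_of_isHomogeneous {p : MvPolynomial (Fin n) K} {k : ℕ} (hp : p.IsHomogeneous k)
    (t : ℂ) (w : Fin n → ℂ) :
    MvPolynomial.aeval (t • w) p = t ^ k * MvPolynomial.aeval w p := by
  rw [MvPolynomial.aeval_def, MvPolynomial.aeval_def, MvPolynomial.eval₂_eq',
    MvPolynomial.eval₂_eq', Finset.mul_sum]
  refine Finset.sum_congr rfl fun d hd => ?_
  have hdeg : ∑ i, d i = k := by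
    have := hp (MvPolynomial.mem_support_iff.mp hd)
    rw [← this, ← Finsupp.degree_eq_sum]
    exact congrFun (congrArg DFunLike.coe Finsupp.degree_eq_weight_one) d
  simp only [Pi.smul_apply, smul_eq_mul, mul_pow, Finset.prod_mul_distrib,
    Finset.prod_pow_eq_pow_sum, hdeg]
  ring

theorem continuous_aeval_left (p : MvPolynomial (Fin n) K) :
    Continuous fun x : Fin n → ℂ => MvPolynomial.aeval x p := by
  have h : AnalyticOnNhd ℂ (fun x : Fin n → ℂ => MvPolynomial.aeval x p) Set.univ :=
    AnalyticOnNhd.aeval_mvPolynomial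
      (fun j x _ => (ContinuousLinearMap.proj (R := ℂ) (φ := fun _ : Fin n => ℂ) j).analyticAt x) _
  exact continuousOn_univ.mp h.continuousOn

/-- Rescaled evaluation of a polynomial near infinity, by homogenization. -/
theorem aeval_smul_eq (p : MvPolynomial (Fin n) K) {t : ℝ} (ht : t ≠ 0) (w : Fin n → ℂ) :
    MvPolynomial.aeval (t • w) p = (t : ℂ) ^ p.totalDegree *
      ∑ k ∈ Finset.range (p.totalDegree + 1), ((t⁻¹ : ℝ) : ℂ) ^ (p.totalDegree - k) *
        MvPolynomial.aeval w (MvPolynomial.homogeneousComponent k p) := by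
  have hts : t • w = (t : ℂ) • w := by ext i; simp
  conv_lhs => rw [← MvPolynomial.sum_homogeneousComponent p]
  rw [map_sum, Finset.mul_sum]
  refine Finset.sum_congr rfl fun k hk => ?_
  have hk' : k ≤ p.totalDegree := by simpa [Nat.lt_succ_iff] using hk
  have hhom := aeval_smul_of_isHomogeneous (MvPolynomial.homogeneousComponent_isHomogeneous k p) (t : ℂ) w
  rw [hts, hhom, ← mul_assoc]
  congr 1
  have htc : (t : ℂ) ≠ 0 := by exact_mod_cast ht
  push_cast
  rw [inv_pow, ← div_eq_mul_inv, eq_div_iff (pow_ne_zero _ htc), ← pow_add]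
  congr 1; omega

/-- In the variable `s = 1/t` the sum extends continuously to `s = 0`, where only the term `k = d`
survives. The product filter makes later estimates uniform on a conical neighbourhood of the ray. -/
theorem tendsto_sum_inv_pow_mul {E : Type*} [TopologicalSpace E] (H : ℕ → E → ℂ)
    (hH : ∀ k, Continuous (H k)) (d : ℕ) (y : E) :
    Tendsto (fun q : ℝ × E => ∑ k ∈ Finset.range (d + 1), ((q.1⁻¹ : ℝ) : ℂ) ^ (d - k) * H k q.2)
      (atTop ×ˢ 𝓝 y) (𝓝 (H d y)) := by
  set F : ℝ × E → ℂ := fun q => ∑ k ∈ Finset.range (d + 1), ((q.1 : ℝ) : ℂ) ^ (d - k) * H k q.2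
    with hF
  have hc : Continuous F := by fun_prop
  have hval : F (0, y) = H d y := by
    rw [hF]
    dsimp only
    rw [Finset.sum_eq_single d]
    · simp
    · intro k hk hne
      have : d - k ≠ 0 := by
        have := Finset.mem_range.mp hk; omega
      simp [this]
    · simp
  have hin : Tendsto (fun q : ℝ × E => (q.1⁻¹, q.2)) (atTop ×ˢ 𝓝 y) (𝓝 (0, y)) := by
    rw [nhds_prod_eq]
    exact (tendsto_inv_atTop_zero.comp tendsto_fst).prodMk tendsto_snd
  have hlim : Tendsto F (𝓝 (0, y)) (𝓝 (H d y)) := hval ▸ hc.tendsto (0, y)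
  refine (hlim.comp hin).congr fun q => ?_
  rw [Function.comp_apply, hF]

theorem tendsto_homogenization (p : MvPolynomial (Fin n) K) (y : Fin n → ℂ) :
    Tendsto (fun q : ℝ × (Fin n → ℂ) =>
      ∑ k ∈ Finset.range (p.totalDegree + 1), ((q.1⁻¹ : ℝ) : ℂ) ^ (p.totalDegree - k) *
        MvPolynomial.aeval q.2 (MvPolynomial.homogeneousComponent k p)) (atTop ×ˢ 𝓝 y)
      (𝓝 (MvPolynomial.aeval y (MvPolynomial.homogeneousComponent p.totalDegree p))) :=
  tendsto_sum_inv_pow_mul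
    (fun k x => MvPolynomial.aeval x (MvPolynomial.homogeneousComponent k p))
    (fun _ => continuous_aeval_left _) _ y

theorem eventually_norm_aeval_smul_le (p : MvPolynomial (Fin n) K) (y : Fin n → ℂ) :
    ∃ C : ℝ, 0 < C ∧ ∀ᶠ q : ℝ × (Fin n → ℂ) in atTop ×ˢ 𝓝 y,
      ‖MvPolynomial.aeval (q.1 • q.2) p‖ ≤ C * q.1 ^ p.totalDegree := by
  set c := MvPolynomial.aeval y (MvPolynomial.homogeneousComponent p.totalDegree p)
  refine ⟨‖c‖ + 1, by positivity, ?_⟩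
  have h1 := (tendsto_homogenization p y).norm.eventually (ge_mem_nhds (lt_add_one ‖c‖))
  filter_upwards [h1, (eventually_gt_atTop (0 : ℝ)).prod_inl _] with q hq hq0
  rw [aeval_smul_eq p hq0.ne', norm_mul, norm_pow, Complex.norm_real, Real.norm_of_nonneg hq0.le,
    mul_comm]
  gcongr

theorem eventually_le_norm_aeval_smul (p : MvPolynomial (Fin n) K) (y : Fin n → ℂ)
    (hy : MvPolynomial.aeval y (MvPolynomial.homogeneousComponent p.totalDegree p) ≠ 0) :
    ∃ c : ℝ, 0 < c ∧ ∀ᶠ q : ℝ × (Fin n → ℂ) in atTop ×ˢ 𝓝 y,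
      c ≤ ‖MvPolynomial.aeval (q.1 • q.2) p‖ := by
  set c := MvPolynomial.aeval y (MvPolynomial.homogeneousComponent p.totalDegree p)
  have hc : 0 < ‖c‖ := norm_pos_iff.mpr hy
  refine ⟨‖c‖ / 2, by positivity, ?_⟩
  have h1 := (tendsto_homogenization p y).norm.eventually (le_mem_nhds (half_lt_self hc))
  filter_upwards [h1, (eventually_ge_atTop (1 : ℝ)).prod_inl _] with q hq hq0
  have hq1 : 0 < q.1 := by linarith
  rw [aeval_smul_eq p hq1.ne', norm_mul, norm_pow, Complex.norm_real, Real.norm_of_nonneg hq1.le]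
  exact hq.trans (le_mul_of_one_le_left (norm_nonneg _) (one_le_pow₀ hq0))

/-- Upper and lower bounds for a root of a polynomial in terms of its coefficients. -/
theorem root_bounds {d : ℕ} {a : ℕ → ℂ} {u : ℂ} {c M : ℝ} (hc : 0 < c)
    (hM : ∀ j ∈ Finset.range (d + 1), ‖a j‖ ≤ M) (h0 : c ≤ ‖a 0‖) (hd : c ≤ ‖a d‖)
    (hsum : ∑ j ∈ Finset.range (d + 1), a j * u ^ j = 0) :
    u ≠ 0 ∧ ‖u‖ ≤ 1 + d * M / c ∧ ‖u‖⁻¹ ≤ 1 + d * M / c := by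
  have hM0 : 0 ≤ M := (norm_nonneg _).trans (hM 0 (by simp))
  have hu : u ≠ 0 := by
    rintro rfl
    rw [Finset.sum_range_succ'] at hsum
    simp at hsum
    rw [hsum] at h0
    simp at h0; linarith
  have hupos : 0 < ‖u‖ := norm_pos_iff.mpr hu
  have hd0 : d ≠ 0 := by
    rintro rfl
    simp at hsum
    rw [hsum] at h0; simp at h0; linarith
  obtain ⟨e, rfl⟩ := Nat.exists_eq_succ_of_ne_zero hd0
  have hquot : 0 ≤ ((e + 1 : ℕ) : ℝ) * M / c := by positivity
  refine ⟨hu, ?_, ?_⟩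
  · by_cases h1 : ‖u‖ ≤ 1
    · linarith
    push Not at h1
    rw [Finset.sum_range_succ, add_eq_zero_iff_neg_eq] at hsum
    have h2 : c * ‖u‖ ^ (e + 1) ≤ ((e + 1 : ℕ) : ℝ) * M * ‖u‖ ^ e := by
      calc c * ‖u‖ ^ (e + 1) ≤ ‖a (e + 1)‖ * ‖u‖ ^ (e + 1) := by gcongr
        _ = ‖∑ j ∈ Finset.range (e + 1), a j * u ^ j‖ := by
          rw [← norm_pow, ← norm_mul, ← hsum, norm_neg]
        _ ≤ ∑ j ∈ Finset.range (e + 1), M * ‖u‖ ^ e := by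
          refine norm_sum_le_of_le _ fun j hj => ?_
          have hj' := Finset.mem_range.mp hj
          rw [norm_mul, norm_pow]
          have := hM j (Finset.mem_range.mpr (by omega))
          gcongr
          · exact h1.le
          · omega
        _ = _ := by simp; ring
    have h3 : c * ‖u‖ ≤ ((e + 1 : ℕ) : ℝ) * M := by
      rw [pow_succ, ← mul_assoc, mul_right_comm] at h2
      exact le_of_mul_le_mul_right h2 (by positivity)
    have : ‖u‖ ≤ ((e + 1 : ℕ) : ℝ) * M / c := by rw [le_div_iff₀ hc]; linarith
    linarith
  · by_cases h1 : 1 ≤ ‖u‖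
    · have := inv_le_one_of_one_le₀ h1
      linarith
    push Not at h1
    rw [Finset.sum_range_succ', add_eq_zero_iff_eq_neg] at hsum
    have h2 : c ≤ ((e + 1 : ℕ) : ℝ) * M * ‖u‖ := by
      calc c ≤ ‖a 0‖ := h0
        _ = ‖∑ j ∈ Finset.range (e + 1), a (j + 1) * u ^ (j + 1)‖ := by
          rw [hsum]; simp
        _ ≤ ∑ j ∈ Finset.range (e + 1), M * ‖u‖ := by
          refine norm_sum_le_of_le _ fun j hj => ?_
          have hj' := Finset.mem_range.mp hj
          rw [norm_mul, norm_pow]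
          have := hM (j + 1) (Finset.mem_range.mpr (by omega))
          gcongr
          rw [pow_succ]
          exact mul_le_of_le_one_left hupos.le (pow_le_one₀ hupos.le h1.le)
        _ = _ := by simp; ring
    have : ‖u‖⁻¹ ≤ ((e + 1 : ℕ) : ℝ) * M / c := by
      rw [le_div_iff₀ hc, inv_mul_le_iff₀ hupos]; linarith
    linarith

/-- An algebraic function is bounded above and below by powers of `t` near a generic ray. -/
theorem eventually_abs_log_norm_le {U : Set (Fin n → ℂ)} (hU : IsCone U) {f : (Fin n → ℂ) → ℂ}
    {p : Polynomial (MvPolynomial (Fin n) K)}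
    (hp : ∀ x ∈ U, Polynomial.eval₂ (MvPolynomial.aeval x : MvPolynomial (Fin n) K →ₐ[K] ℂ).toRingHom
        (f x) p = 0)
    {y : Fin n → ℂ} (hyU : y ∈ U)
    (h0 : MvPolynomial.aeval y
      (MvPolynomial.homogeneousComponent (p.coeff 0).totalDegree (p.coeff 0)) ≠ 0)
    (hd : MvPolynomial.aeval y
      (MvPolynomial.homogeneousComponent p.leadingCoeff.totalDegree p.leadingCoeff) ≠ 0) :
    ∃ M : ℝ, 0 < M ∧ ∀ᶠ q : ℝ × (Fin n → ℂ) in atTop ×ˢ 𝓝 y,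
      f (q.1 • q.2) ≠ 0 ∧ |Real.log ‖f (q.1 • q.2)‖| ≤ M * Real.log q.1 := by
  obtain ⟨c0, hc0, hlow0⟩ := eventually_le_norm_aeval_smul _ y h0
  obtain ⟨cd, hcd, hlowd⟩ := eventually_le_norm_aeval_smul _ y hd
  choose C hC hup using fun j => eventually_norm_aeval_smul_le (p.coeff j) y
  set d := p.natDegree with hd_def
  set D := ∑ j ∈ Finset.range (d + 1), (p.coeff j).totalDegree with hD
  set B := ∑ j ∈ Finset.range (d + 1), C j with hB
  have hall : ∀ᶠ q : ℝ × (Fin n → ℂ) in atTop ×ˢ 𝓝 y, ∀ j ∈ Finset.range (d + 1),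
      ‖MvPolynomial.aeval (q.1 • q.2) (p.coeff j)‖ ≤ C j * q.1 ^ (p.coeff j).totalDegree :=
    (Finset.eventually_all _).mpr fun j _ => hup j
  set c := min c0 cd with hc
  have hcpos : 0 < c := lt_min hc0 hcd
  have hB0 : 0 ≤ B := Finset.sum_nonneg fun j _ => (hC j).le
  -- Chosen so that the root bound is at most `A * t ^ D`, hence at most `t ^ (D + 1)` once `t ≥ A`.
  set A := 1 + d * B / c with hA
  have hA1 : 1 ≤ A := by have : 0 ≤ d * B / c := by positivity
                         linarith
  refine ⟨D + 1, by positivity, ?_⟩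
  have hbig : ∀ᶠ t : ℝ in atTop, A ≤ t ∧ 1 ≤ t :=
    (eventually_ge_atTop A).and (eventually_ge_atTop 1)
  have hyU' : ∀ᶠ w in 𝓝 y, w ∈ U := hU.1.mem_nhds hyU
  filter_upwards [hlow0, hlowd, hall, hbig.prod_inl _, hyU'.prod_inr _]
    with q hq0 hqd hqall ⟨hqA, hq1⟩ hqU
  have hqpos : 0 < q.1 := by linarith
  have hroot := hp _ (hU.2 q.1 hq1 q.2 hqU)
  rw [Polynomial.eval₂_eq_sum_range] at hroot
  obtain ⟨hne, h1, h2⟩ := root_bounds (d := d)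
    (a := fun j => MvPolynomial.aeval (q.1 • q.2) (p.coeff j)) (M := B * q.1 ^ D) hcpos
    (fun j hj => by
      refine (hqall j hj).trans ?_
      gcongr
      · exact Finset.single_le_sum (f := C) (fun i _ => (hC i).le) hj
      · exact Finset.single_le_sum (f := fun j => (p.coeff j).totalDegree)
          (fun i _ => Nat.zero_le _) hj)
    ((min_le_left _ _).trans hq0) ((min_le_right _ _).trans hqd) hroot
  have hbound : 1 + d * (B * q.1 ^ D) / c ≤ q.1 ^ (D + 1) := by
    have hpow : 1 ≤ q.1 ^ D := one_le_pow₀ hq1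
    calc 1 + d * (B * q.1 ^ D) / c ≤ q.1 ^ D + d * (B * q.1 ^ D) / c := by gcongr
      _ = A * q.1 ^ D := by rw [hA]; ring
      _ ≤ q.1 * q.1 ^ D := by gcongr
      _ = _ := by ring
  have hupos := norm_pos_iff.mpr hne
  refine ⟨hne, abs_le.mpr ⟨?_, ?_⟩⟩
  · have := Real.log_le_log (inv_pos.mpr hupos) (h2.trans hbound)
    rw [Real.log_inv, Real.log_pow] at this
    push_cast at this
    linarith
  · have := Real.log_le_log hupos (h1.trans hbound)
    rw [Real.log_pow] at this
    push_cast at this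
    linarith

end Growth

/-! ### Slow variation of logarithms and solutions by contraction -/

section FixedPoint

open Metric

/-- A nonvanishing holomorphic function on a disc with `|log ‖φ‖| ≤ M` has a logarithm with
controlled growth at the centre. -/
theorem exists_eq_mul_exp_of_disc {φ : ℂ → ℂ} {R M : ℝ} (hR : 0 < R) (hM : 0 < M)
    (hφ : DifferentiableOn ℂ φ (ball 0 R)) (hne : ∀ z ∈ ball 0 R, φ z ≠ 0)
    (hb : ∀ z ∈ ball 0 R, |Real.log ‖φ z‖| ≤ M) {τ : ℂ} (hτ : ‖τ‖ ≤ R / 2) :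
    ∃ G : ℂ, φ τ = φ 0 * Complex.exp G ∧ ‖G‖ ≤ 8 * M * ‖τ‖ / R := by
  have hquot : DifferentiableOn ℂ (fun z => deriv φ z / φ z) (ball 0 R) :=
    (hφ.deriv isOpen_ball).div hφ hne
  obtain ⟨g, hg0, hg⟩ := hquot.isExactOn_ball.with_val_at 0 0
  have h0mem : (0 : ℂ) ∈ ball (0 : ℂ) R := mem_ball_self hR
  have hder : ∀ z ∈ ball (0 : ℂ) R, HasDerivAt (fun z => φ z * Complex.exp (-g z)) 0 z := by
    intro z hz
    have h1 : HasDerivAt φ (deriv φ z) z :=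
      (hφ.differentiableAt (isOpen_ball.mem_nhds hz)).hasDerivAt
    have h2 := h1.mul (hg z hz).neg.cexp
    have h3 := hne z hz
    have h4 : deriv φ z * Complex.exp (-g z) +
        φ z * (Complex.exp (-g z) * -(deriv φ z / φ z)) = 0 := by
      field_simp
      ring
    exact h4 ▸ h2
  have hconst : ∀ z ∈ ball (0 : ℂ) R, φ z * Complex.exp (-g z) = φ 0 := by
    intro z hz
    have := isOpen_ball.is_const_of_deriv_eq_zero (convex_ball (0 : ℂ) R).isPreconnected
      (fun z hz => (hder z hz).differentiableAt.differentiableWithinAt)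
      (fun z hz => (hder z hz).deriv) hz h0mem
    simpa [hg0] using this
  have hφg : ∀ z ∈ ball (0 : ℂ) R, φ z = φ 0 * Complex.exp (g z) := by
    intro z hz
    rw [← hconst z hz, mul_assoc, ← Complex.exp_add]
    simp
  have hτR : τ ∈ ball (0 : ℂ) R := by rw [mem_ball_zero_iff]; linarith
  refine ⟨g τ, hφg τ hτR, ?_⟩
  -- `Re g` is the difference of two values of `log ‖φ‖`; a one-sided bound on it is all that
  -- Borel–Carathéodory needs.
  have hre : Set.MapsTo g (ball 0 R) {z | z.re ≤ 2 * M} := by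
    intro z hz
    have h1 := congrArg (fun z => Real.log ‖z‖) (hφg z hz)
    simp only [norm_mul, Complex.norm_exp] at h1
    rw [Real.log_mul (norm_ne_zero_iff.mpr (hne 0 h0mem)) (Real.exp_pos _).ne',
      Real.log_exp] at h1
    have h2 := abs_le.mp (hb z hz)
    have h3 := abs_le.mp (hb 0 h0mem)
    change (g z).re ≤ 2 * M
    linarith
  have hgd : DifferentiableOn ℂ g (ball 0 R) :=
    fun z hz => (hg z hz).differentiableAt.differentiableWithinAt
  refine (Complex.borelCaratheodory_zero (by positivity) hgd hre hR hτR hg0).trans ?_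
  calc 2 * (2 * M) * ‖τ‖ / (R - ‖τ‖) ≤ 2 * (2 * M) * ‖τ‖ / (R / 2) := by
        gcongr; linarith
    _ = 8 * M * ‖τ‖ / R := by field_simp; ring

variable {E : Type*} [NormedAddCommGroup E] [NormedSpace ℂ E]

/-- Restriction to the complex line `τ ↦ w + τ • v` reduces this to the disc of radius `R / ‖v‖`,
evaluated at `τ = 1`. -/
theorem exists_eq_mul_exp_of_ball {f : E → ℂ} {w : E} {R M : ℝ} (hR : 0 < R) (hM : 0 < M)
    (hf : DifferentiableOn ℂ f (ball w R)) (hne : ∀ z ∈ ball w R, f z ≠ 0)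
    (hb : ∀ z ∈ ball w R, |Real.log ‖f z‖| ≤ M) {v : E} (hv : ‖v‖ ≤ R / 2) :
    ∃ G : ℂ, f (w + v) = f w * Complex.exp G ∧ ‖G‖ ≤ 8 * M * ‖v‖ / R := by
  rcases eq_or_ne v 0 with rfl | hv0
  · exact ⟨0, by simp, by simp⟩
  have hvpos : 0 < ‖v‖ := norm_pos_iff.mpr hv0
  have hmaps : Set.MapsTo (fun τ : ℂ => w + τ • v) (ball 0 (R / ‖v‖)) (ball w R) := by
    intro τ hτ
    rw [mem_ball_zero_iff, lt_div_iff₀ hvpos] at hτ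
    simpa [norm_smul] using hτ
  obtain ⟨G, hG, hGn⟩ := exists_eq_mul_exp_of_disc (φ := fun τ : ℂ => f (w + τ • v)) (τ := 1)
    (div_pos hR hvpos) hM (hf.comp (by fun_prop) hmaps) (fun z hz => hne _ (hmaps hz))
    (fun z hz => hb _ (hmaps hz)) (by
      rw [norm_one, div_div, le_div_iff₀ (by positivity)]; linarith)
  refine ⟨G, by simpa using hG, hGn.trans_eq ?_⟩
  rw [norm_one]
  field_simp

theorem log_exp_of_norm_le {G : ℂ} (hG : ‖G‖ ≤ 3) : Complex.log (Complex.exp G) = G := by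
  have h := abs_le.mp ((Complex.abs_im_le_norm G).trans hG)
  exact Complex.log_exp (by linarith [Real.pi_gt_three]) (by linarith [Real.pi_gt_three])

/-- Solutions of `exp (a i) = f i a` near a period `w`, on a ball where the `f i` do not vanish and
are of moderate size. -/
theorem exists_exp_eq_near {n : ℕ} {f : Fin n → (Fin n → ℂ) → ℂ} {w : Fin n → ℂ} {R M : ℝ}
    (hM : 0 < M) (hRM : 16 * (M + 1) * (M + 5) ≤ R)
    (hf : ∀ i, DifferentiableOn ℂ (f i) (ball w R)) (hne : ∀ i, ∀ z ∈ ball w R, f i z ≠ 0)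
    (hb : ∀ i, ∀ z ∈ ball w R, |Real.log ‖f i z‖| ≤ M) (hw : ∀ i, Complex.exp (w i) = 1) :
    ∃ a : Fin n → ℂ, ‖a - w‖ ≤ M + 5 ∧ ∀ i, Complex.exp (a i) = f i a ∧
      |Real.log ‖f i a‖ - Real.log ‖f i w‖| ≤ 1 := by
  -- Room for `‖log (f i w)‖ ≤ M + π < M + 4` plus a correction of norm at most `1/2`.
  set ρ := M + 5 with hρ
  have hρ0 : 0 < ρ := by positivity
  have hMρ : 16 * M * ρ ≤ R := by nlinarith
  have hρR : 16 * ρ ≤ R := by nlinarith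
  have hR : 0 < R := by linarith
  have hwm : w ∈ ball w R := mem_ball_self hR
  have hmem : ∀ v : Fin n → ℂ, ‖v‖ ≤ ρ → w + v ∈ ball w R := by
    intro v hv
    rw [mem_ball, dist_eq_norm, add_sub_cancel_left]; linarith
  -- behaviour of `f i` near the centre
  have key1 : ∀ i, ∀ v : Fin n → ℂ, ‖v‖ ≤ ρ →
      ∃ G : ℂ, f i (w + v) = f i w * Complex.exp G ∧ ‖G‖ ≤ 1 / 2 := by
    intro i v hv
    obtain ⟨G, hG, hGn⟩ := exists_eq_mul_exp_of_ball hR hM (hf i) (hne i) (hb i) (v := v)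
      (by linarith)
    refine ⟨G, hG, hGn.trans ?_⟩
    rw [div_le_iff₀ hR]
    nlinarith
  have key2 : ∀ i, ∀ v v' : Fin n → ℂ, ‖v‖ ≤ ρ → ‖v'‖ ≤ ρ →
      ∃ G : ℂ, f i (w + v') = f i (w + v) * Complex.exp G ∧ ‖G‖ ≤ 2 ∧
        ‖G‖ ≤ 1 / 2 * ‖v' - v‖ := by
    intro i v v' hv hv'
    have hsub : ball (w + v) (R / 2) ⊆ ball w R := by
      apply ball_subset_ball'
      rw [dist_eq_norm, add_sub_cancel_left]; linarith
    have hvv : ‖v' - v‖ ≤ 2 * ρ := (norm_sub_le _ _).trans (by linarith)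
    obtain ⟨G, hG, hGn⟩ := exists_eq_mul_exp_of_ball (half_pos hR) hM ((hf i).mono hsub)
      (fun z hz => hne i z (hsub hz)) (fun z hz => hb i z (hsub hz)) (v := v' - v)
      (by linarith)
    have heq : 8 * M * ‖v' - v‖ / (R / 2) = 16 * M / R * ‖v' - v‖ := by field_simp; ring
    rw [heq] at hGn
    have h1 : 16 * M / R * (2 * ρ) ≤ 2 := by
      rw [div_mul_eq_mul_div, div_le_iff₀ hR]; linarith
    have h2 : 16 * M / R ≤ 1 / 2 := by
      rw [div_le_iff₀ hR]; nlinarith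
    refine ⟨G, by rw [← hG]; congr 1; abel, hGn.trans (le_trans ?_ h1), hGn.trans ?_⟩
    · gcongr
    · gcongr
  -- Taking the logarithm of the quotient keeps its argument away from the branch cut, whereas `log
  -- (f i (w + v))` itself could jump. A fixed point `v` satisfies `exp (v i) = f i (w + v)`.
  set Ψ : (Fin n → ℂ) → Fin n → ℂ := fun v i =>
    Complex.log (f i w) + Complex.log (f i (w + v) / f i w) with hΨ
  have hlog : ∀ i, ‖Complex.log (f i w)‖ ≤ M + 4 := by
    intro i
    refine (Complex.norm_le_abs_re_add_abs_im _).trans ?_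
    rw [Complex.log_re, Complex.log_im]
    have := hb i w hwm
    have := Complex.abs_arg_le_pi (f i w)
    linarith [Real.pi_lt_four]
  have hmaps : Set.MapsTo Ψ (closedBall 0 ρ) (closedBall 0 ρ) := by
    intro v hv
    rw [mem_closedBall_zero_iff] at hv ⊢
    rw [pi_norm_le_iff_of_nonneg hρ0.le]
    intro i
    obtain ⟨G, hG, hGn⟩ := key1 i v hv
    have : Complex.log (f i (w + v) / f i w) = G := by
      rw [hG, mul_div_cancel_left₀ _ (hne i w hwm), log_exp_of_norm_le (by linarith)]
    simp only [hΨ, this]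
    refine (norm_add_le _ _).trans ?_
    linarith [hlog i]
  have hlip : LipschitzWith (1 / 2) (hmaps.restrict Ψ _ _) := by
    refine LipschitzWith.of_dist_le_mul fun v v' => ?_
    obtain ⟨v, hv⟩ := v
    obtain ⟨v', hv'⟩ := v'
    rw [mem_closedBall_zero_iff] at hv hv'
    rw [Subtype.dist_eq, Subtype.dist_eq]
    simp only [Set.MapsTo.val_restrict_apply]
    rw [dist_comm, dist_comm v v', dist_eq_norm, dist_eq_norm]
    rw [pi_norm_le_iff_of_nonneg (by positivity)]
    intro i
    obtain ⟨G, hG, hGn⟩ := key1 i v hv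
    obtain ⟨G', hG', hGn', hGl⟩ := key2 i v v' hv hv'
    have h1 : Complex.log (f i (w + v) / f i w) = G := by
      rw [hG, mul_div_cancel_left₀ _ (hne i w hwm), log_exp_of_norm_le (by linarith)]
    -- The bounds `1/2` and `2` keep `‖G + G'‖` below `3 < π`, so the principal logarithm inverts
    -- `exp` here.
    have h2 : Complex.log (f i (w + v') / f i w) = G + G' := by
      rw [hG', hG, mul_assoc, ← Complex.exp_add, mul_div_cancel_left₀ _ (hne i w hwm),
        log_exp_of_norm_le ((norm_add_le _ _).trans (by linarith))]
    have h3 : (Ψ v' - Ψ v) i = G' := by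
      simp only [hΨ, Pi.sub_apply, h1, h2]; ring
    rw [h3]
    simpa using hGl
  obtain ⟨v, hv, hfix, -⟩ := ContractingWith.exists_fixedPoint'
    (isClosed_closedBall (x := (0 : Fin n → ℂ)) (ε := ρ)).isComplete hmaps
    ⟨by norm_num, hlip⟩ (mem_closedBall_self hρ0.le) (edist_ne_top _ _)
  rw [mem_closedBall_zero_iff] at hv
  refine ⟨w + v, by simpa using hv, fun i => ⟨?_, ?_⟩⟩
  · have hvi : v i = Complex.log (f i w) + Complex.log (f i (w + v) / f i w) :=
      (congrFun hfix i).symm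
    have h1 := hne i w hwm
    have h2 := hne i _ (hmem v hv)
    rw [Pi.add_apply, Complex.exp_add, hw i, one_mul, hvi, Complex.exp_add, Complex.exp_log h1,
      Complex.exp_log (div_ne_zero h2 h1), mul_div_cancel₀ _ h1]
  · obtain ⟨G, hG, hGn⟩ := key1 i v hv
    rw [hG, norm_mul, Complex.norm_exp, Real.log_mul (norm_ne_zero_iff.mpr (hne i w hwm))
      (Real.exp_pos _).ne', Real.log_exp, add_sub_cancel_left]
    linarith [Complex.abs_re_le_norm G]

end FixedPoint

/-! ### Growth exponents and the Newton polygon -/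

section NewtonPolygon

theorem tendsto_log_natCast : Tendsto (fun N : ℕ => Real.log (N : ℝ)) atTop atTop :=
  Real.tendsto_log_atTop.comp tendsto_natCast_atTop_atTop

/-- If `‖v N‖ / N ^ s` has a positive limit then `v` has growth exponent `s`. -/
theorem tendsto_log_norm_div_log {v : ℕ → ℂ} {s c : ℝ} (hc : 0 < c)
    (hv : Tendsto (fun N : ℕ => ‖v N‖ / (N : ℝ) ^ s) atTop (𝓝 c)) :
    (∀ᶠ N in atTop, v N ≠ 0) ∧
      Tendsto (fun N : ℕ => Real.log ‖v N‖ / Real.log N) atTop (𝓝 s) := by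
  have hne : ∀ᶠ N in atTop, v N ≠ 0 := by
    filter_upwards [hv.eventually (lt_mem_nhds hc)] with N hN h0
    simp [h0] at hN
  refine ⟨hne, ?_⟩
  have h1 : Tendsto (fun N : ℕ => Real.log (‖v N‖ / (N : ℝ) ^ s) / Real.log N + s) atTop
      (𝓝 (0 + s)) :=
    ((hv.log hc.ne').div_atTop tendsto_log_natCast).add_const s
  rw [zero_add] at h1
  refine h1.congr' ?_
  filter_upwards [hne, eventually_gt_atTop 1] with N hN hN1
  have hN1' : (1 : ℝ) < N := by exact_mod_cast hN1
  have hlog : Real.log N ≠ 0 := (Real.log_pos hN1').ne'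
  rw [Real.log_div (norm_ne_zero_iff.mpr hN) (Real.rpow_pos_of_pos (by linarith) s).ne',
    Real.log_rpow (by linarith)]
  field_simp
  ring

theorem tendsto_log_norm_eval_div_log {P : Polynomial ℂ} (hP : P ≠ 0) :
    (∀ᶠ N : ℕ in atTop, P.eval (N : ℂ) ≠ 0) ∧
      Tendsto (fun N : ℕ => Real.log ‖P.eval (N : ℂ)‖ / Real.log N) atTop (𝓝 P.natDegree) := by
  refine tendsto_log_norm_div_log (c := ‖P.leadingCoeff‖)
    (norm_pos_iff.mpr (Polynomial.leadingCoeff_ne_zero.mpr hP)) ?_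
  have hinv : Tendsto (fun N : ℕ => ((N : ℂ))⁻¹) atTop (𝓝 0) := tendsto_inv_atTop_nhds_zero_nat
  have h1 := ((P.reverse.continuous.tendsto 0).comp hinv).norm
  -- `P(N) / N ^ deg P` is the reversed polynomial at `1/N`, which tends to the leading coefficient.
  rw [← Polynomial.coeff_zero_eq_eval_zero, Polynomial.coeff_zero_reverse] at h1
  refine h1.congr' ?_
  filter_upwards [eventually_gt_atTop 0] with N hN
  have hNc : (N : ℂ) ≠ 0 := by exact_mod_cast hN.ne'
  let _ := invertibleOfNonzero hNc
  have h2 := Polynomial.eval₂_reverse_mul_pow (RingHom.id ℂ) (N : ℂ) P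
  rw [invOf_eq_inv] at h2
  simp only [Polynomial.eval₂_id] at h2
  rw [← h2, norm_mul, norm_pow, Complex.norm_natCast, Real.rpow_natCast, Function.comp_apply]
  have : (N : ℝ) ≠ 0 := by exact_mod_cast hN.ne'
  field_simp

theorem tendsto_div_zero_of_exponent_lt {v w : ℕ → ℂ} {e e' : ℝ} (hlt : e < e')
    (hv0 : ∀ᶠ N in atTop, v N ≠ 0) (hw0 : ∀ᶠ N in atTop, w N ≠ 0)
    (hv : Tendsto (fun N : ℕ => Real.log ‖v N‖ / Real.log N) atTop (𝓝 e))
    (hw : Tendsto (fun N : ℕ => Real.log ‖w N‖ / Real.log N) atTop (𝓝 e')) :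
    v =o[atTop] w := by
  rw [isLittleO_iff_tendsto' (hw0.mono fun N h h' => absurd h' h), tendsto_zero_iff_norm_tendsto_zero]
  have h1 : Tendsto (fun N : ℕ => (Real.log ‖v N‖ / Real.log N - Real.log ‖w N‖ / Real.log N) *
      Real.log N) atTop atBot :=
    (hv.sub hw).neg_mul_atTop (by linarith) tendsto_log_natCast
  refine (Real.tendsto_exp_atBot.comp h1).congr' ?_
  filter_upwards [hv0, hw0, eventually_gt_atTop 1] with N h2 h3 hN
  have hlog : Real.log N ≠ 0 := (Real.log_pos (by exact_mod_cast hN)).ne'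
  rw [Function.comp_apply, ← sub_div, div_mul_cancel₀ _ hlog, Real.exp_sub,
    Real.exp_log (norm_pos_iff.mpr h2), Real.exp_log (norm_pos_iff.mpr h3), norm_div]

/-- Newton polygon: the growth exponent of a root of a polynomial equation with coefficients in
`ℂ[N]` makes two of the terms balance. -/
theorem exists_balanced_terms {d : ℕ} {P : ℕ → Polynomial ℂ} {u : ℕ → ℂ} {s : ℝ}
    (hP : ∃ j ∈ Finset.range (d + 1), P j ≠ 0) (hu : ∀ᶠ N in atTop, u N ≠ 0)
    (hs : Tendsto (fun N : ℕ => Real.log ‖u N‖ / Real.log N) atTop (𝓝 s))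
    (hsum : ∀ᶠ N : ℕ in atTop, ∑ j ∈ Finset.range (d + 1), (P j).eval (N : ℂ) * u N ^ j = 0) :
    ∃ i ∈ Finset.range (d + 1), ∃ j ∈ Finset.range (d + 1), i ≠ j ∧
      ((P i).natDegree : ℝ) + i * s = (P j).natDegree + j * s := by
  classical
  set e : ℕ → ℝ := fun j => (P j).natDegree + j * s with he
  set T : ℕ → ℕ → ℂ := fun j N => (P j).eval (N : ℂ) * u N ^ j with hT
  have hT0 : ∀ j, P j ≠ 0 → ∀ᶠ N in atTop, T j N ≠ 0 := by
    intro j hj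
    filter_upwards [(tendsto_log_norm_eval_div_log hj).1, hu] with N h1 h2
    exact mul_ne_zero h1 (pow_ne_zero _ h2)
  have hTe : ∀ j, P j ≠ 0 →
      Tendsto (fun N : ℕ => Real.log ‖T j N‖ / Real.log N) atTop (𝓝 (e j)) := by
    intro j hj
    obtain ⟨h1, h2⟩ := tendsto_log_norm_eval_div_log hj
    refine (h2.add (hs.const_mul (j : ℝ))).congr' ?_
    filter_upwards [h1, hu] with N h3 h4
    simp only [hT]
    rw [norm_mul, norm_pow, Real.log_mul (norm_ne_zero_iff.mpr h3)
      (pow_ne_zero _ (norm_ne_zero_iff.mpr h4)), Real.log_pow]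
    ring
  set J := (Finset.range (d + 1)).filter fun j => P j ≠ 0 with hJ
  obtain ⟨j0, hj0, hPj0⟩ := hP
  obtain ⟨i, hiJ, himax⟩ := J.exists_max_image e ⟨j0, by simp [hJ, hPj0]; simpa using hj0⟩
  obtain ⟨hir, hPi⟩ := Finset.mem_filter.mp hiJ
  by_contra hcon
  push Not at hcon
  -- Without a balance the maximal exponent is attained only once, so `T i` dominates all other
  -- terms and cannot be cancelled by them.
  have hlittle : ∀ j ∈ (Finset.range (d + 1)).erase i, T j =o[atTop] T i := by
    intro j hj
    obtain ⟨hji, hjr⟩ := Finset.mem_erase.mp hj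
    by_cases hPj : P j = 0
    · have : T j = fun _ => 0 := by ext N; simp [hT, hPj]
      rw [this]
      exact isLittleO_zero _ _
    · have hle := himax j (Finset.mem_filter.mpr ⟨hjr, hPj⟩)
      have hne := hcon j hjr i hir hji
      exact tendsto_div_zero_of_exponent_lt (lt_of_le_of_ne hle hne) (hT0 j hPj) (hT0 i hPi)
        (hTe j hPj) (hTe i hPi)
  have hsumo : (fun N => ∑ j ∈ (Finset.range (d + 1)).erase i, T j N) =o[atTop] T i :=
    IsLittleO.fun_sum hlittle
  have hself : T i =o[atTop] T i := by
    refine (hsumo.neg_left).congr' ?_ EventuallyEq.rfl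
    filter_upwards [hsum] with N hN
    rw [← Finset.add_sum_erase _ _ hir] at hN
    exact (eq_neg_of_add_eq_zero_left hN).symm
  exact isLittleO_irrefl (hT0 i hPi).frequently hself

/-- The finite set of possible growth exponents of a root of a polynomial of degree `d` whose
coefficients have degree at most `D`. -/
def slopes (d D : ℕ) : Finset ℚ :=
  (((Finset.range (d + 1)) ×ˢ (Finset.range (d + 1))) ×ˢ
    ((Finset.range (D + 1)) ×ˢ (Finset.range (D + 1)))).image
      fun q => ((q.2.1 : ℚ) - q.2.2) / ((q.1.1 : ℚ) - q.1.2)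

variable {n : ℕ} {K : Type} [Field K] [Algebra K ℂ]

/-- Along the ray the coefficients of `p` become polynomials in `N`, so two terms balance and the
exponent is a quotient of bounded integers. The finite set depends on `p` alone and not on `y`,
which lets `y` be chosen afterwards. -/
theorem exponent_mem_slopes {U : Set (Fin n → ℂ)} (hU : IsCone U) {f : (Fin n → ℂ) → ℂ}
    {p : Polynomial (MvPolynomial (Fin n) K)}
    (hp : ∀ x ∈ U, Polynomial.eval₂ (MvPolynomial.aeval x : MvPolynomial (Fin n) K →ₐ[K] ℂ).toRingHom
        (f x) p = 0)
    {y : Fin n → ℂ} (hyU : y ∈ U)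
    (h0 : MvPolynomial.aeval y
      (MvPolynomial.homogeneousComponent (p.coeff 0).totalDegree (p.coeff 0)) ≠ 0)
    (hu : ∀ᶠ N : ℕ in atTop, f ((N : ℝ) • y) ≠ 0) {s : ℝ}
    (hs : Tendsto (fun N : ℕ => Real.log ‖f ((N : ℝ) • y)‖ / Real.log N) atTop (𝓝 s)) :
    ∃ σ ∈ slopes p.natDegree (∑ j ∈ Finset.range (p.natDegree + 1), (p.coeff j).totalDegree),
      s = (σ : ℝ) := by
  set P : ℕ → Polynomial ℂ := fun j => MvPolynomial.aeval
    (fun i => Polynomial.C (y i) * Polynomial.X) (MvPolynomial.map (algebraMap K ℂ) (p.coeff j))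
    with hP
  have heval : ∀ j, ∀ N : ℕ, (P j).eval (N : ℂ) = MvPolynomial.aeval ((N : ℝ) • y) (p.coeff j) := by
    intro j N
    have h1 : (P j).eval (N : ℂ) = MvPolynomial.aeval
        (fun i => (Polynomial.C (y i) * Polynomial.X : Polynomial ℂ).eval (N : ℂ))
        (MvPolynomial.map (algebraMap K ℂ) (p.coeff j)) := by
      simp only [hP]
      rw [← Polynomial.coe_aeval_eq_eval, ← MvPolynomial.comp_aeval_apply]
    rw [h1, MvPolynomial.aeval_map_algebraMap]
    have h2 : (fun i => (Polynomial.C (y i) * Polynomial.X : Polynomial ℂ).eval (N : ℂ)) =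
        (N : ℝ) • y := by
      funext i
      rw [Polynomial.eval_mul, Polynomial.eval_C, Polynomial.eval_X, Pi.smul_apply,
        Complex.real_smul, Complex.ofReal_natCast, mul_comm]
    rw [h2]
  have hdeg : ∀ j, (P j).natDegree ≤ (p.coeff j).totalDegree := by
    intro j
    have h1 := MvPolynomial.aeval_natDegree_le (MvPolynomial.map (algebraMap K ℂ) (p.coeff j))
      (Finset.sup_mono (MvPolynomial.support_map_subset _ _))
      (fun i => (Polynomial.C (y i) * Polynomial.X : Polynomial ℂ)) (n := 1)
      (fun i => Polynomial.natDegree_C_mul_le _ _ |>.trans Polynomial.natDegree_X_le)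
    rw [mul_one] at h1
    exact h1
  have hP0 : P 0 ≠ 0 := by
    obtain ⟨c, hc, hlow⟩ := eventually_le_norm_aeval_smul _ y h0
    have h1 : ∀ᶠ t : ℝ in atTop, c ≤ ‖MvPolynomial.aeval (t • y) (p.coeff 0)‖ :=
      hlow.curry.mono fun t ht => ht.self_of_nhds
    obtain ⟨N, hN⟩ := (tendsto_natCast_atTop_atTop.eventually h1).exists
    intro h
    rw [← heval, h] at hN
    simp at hN
    linarith
  obtain ⟨i, hi, j, hj, hij, hbal⟩ := exists_balanced_terms (d := p.natDegree) (P := P)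
    ⟨0, by simp, hP0⟩ hu hs (by
      filter_upwards [eventually_ge_atTop 1] with N hN
      have := hp _ (hU.2 N (by exact_mod_cast hN) y hyU)
      rw [Polynomial.eval₂_eq_sum_range] at this
      simp only [heval]
      exact this)
  have hle : ∀ k ∈ Finset.range (p.natDegree + 1), (P k).natDegree ∈
      Finset.range (∑ j ∈ Finset.range (p.natDegree + 1), (p.coeff j).totalDegree + 1) := by
    intro k hk
    rw [Finset.mem_range, Nat.lt_succ_iff]
    exact (hdeg k).trans (Finset.single_le_sum (f := fun j => (p.coeff j).totalDegree)
      (fun i _ => Nat.zero_le _) hk)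
  refine ⟨(((P j).natDegree : ℚ) - (P i).natDegree) / ((i : ℚ) - j), ?_, ?_⟩
  · rw [slopes, Finset.mem_image]
    exact ⟨((i, j), ((P j).natDegree, (P i).natDegree)), by
      simp only [Finset.mem_product]
      exact ⟨⟨hi, hj⟩, hle j hj, hle i hi⟩, rfl⟩
  · have hij' : (i : ℝ) - j ≠ 0 := sub_ne_zero.mpr (by exact_mod_cast hij)
    push_cast
    rw [eq_div_iff hij']
    linarith

end NewtonPolygon

/-! ### Transcendence degree and Schanuel's conjecture -/

section Transcendence

/-- The constant coefficient survives specialisation at `a`, so the specialised polynomial over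
`ℚ(a)` is still nonzero. -/
theorem isAlgebraic_adjoin_of_eval₂_eq_zero {n : ℕ} {a : Fin n → ℂ} {u : ℂ}
    {p : Polynomial (MvPolynomial (Fin n) ℚ)} (h0 : MvPolynomial.aeval a (p.coeff 0) ≠ (0 : ℂ))
    (hp : Polynomial.eval₂ (MvPolynomial.aeval a : MvPolynomial (Fin n) ℚ →ₐ[ℚ] ℂ).toRingHom u p = 0) :
    IsAlgebraic (IntermediateField.adjoin ℚ (Set.range a)) u := by
  set F := IntermediateField.adjoin ℚ (Set.range a) with hF
  set φ : MvPolynomial (Fin n) ℚ →ₐ[ℚ] F := MvPolynomial.aeval fun i =>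
    (⟨a i, IntermediateField.subset_adjoin _ _ ⟨i, rfl⟩⟩ : F) with hφ
  have hcomp : ∀ q, algebraMap F ℂ (φ q) = MvPolynomial.aeval a q := by
    intro q
    have : ((IsScalarTower.toAlgHom ℚ F ℂ).comp φ) = MvPolynomial.aeval a := by
      ext i
      simp [hφ]
    exact DFunLike.congr_fun this q
  refine ⟨p.map φ.toRingHom, fun h => h0 ?_, ?_⟩
  · have h1 := congrArg (fun q => Polynomial.coeff q 0) h
    simp only [Polynomial.coeff_map, Polynomial.coeff_zero] at h1
    rw [← hcomp]
    have h2 : φ (p.coeff 0) = 0 := h1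
    rw [h2, map_zero]
  · rw [Polynomial.aeval_def, Polynomial.eval₂_map]
    have : (algebraMap F ℂ).comp φ.toRingHom =
        (MvPolynomial.aeval a : MvPolynomial (Fin n) ℚ →ₐ[ℚ] ℂ).toRingHom :=
      RingHom.ext hcomp
    rw [this, hp]

theorem trdeg_eq_of_isAlgebraic (k F L : Type) [Field k] [Field F] [Field L] [Algebra k F]
    [Algebra F L] [Algebra k L] [IsScalarTower k F L] [Algebra.IsAlgebraic F L] :
    Algebra.trdeg k L = Algebra.trdeg k F := by
  rw [← trdeg_add_eq k F (A := L), trdeg_eq_zero (R := F) (A := L), add_zero]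

/-- The field in Schanuel's conjecture for the pair lies in the algebraic closure of `ℚ(a)` in `ℂ`,
which has the same transcendence degree as `ℚ(a)`. -/
theorem two_le_trdeg_adjoin (hSC : SchanuelConjecture) {n : ℕ} {a : Fin n → ℂ} {i j : Fin n}
    (hli : LinearIndependent ℚ ![a i, a j])
    (halg : ∀ i, IsAlgebraic (IntermediateField.adjoin ℚ (Set.range a)) (Complex.exp (a i))) :
    2 ≤ Algebra.trdeg ℚ (IntermediateField.adjoin ℚ (Set.range a)) := by
  set F := IntermediateField.adjoin ℚ (Set.range a) with hF
  have h1 := hSC 2 _ hli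
  set E := IntermediateField.adjoin ℚ
    (Set.range ![a i, a j] ∪ Set.range fun k => Complex.exp (![a i, a j] k)) with hE
  set F' := algebraicClosure F ℂ with hF'
  have hF'mem : ∀ x : ℂ, IsAlgebraic F x → x ∈ F' := fun x hx =>
    mem_algebraicClosure_iff.mpr hx
  have ha : ∀ k, a k ∈ F' := fun k =>
    F'.algebraMap_mem (⟨a k, IntermediateField.subset_adjoin _ _ ⟨k, rfl⟩⟩ : F)
  have hle : E ≤ F'.restrictScalars ℚ := by
    rw [hE, IntermediateField.adjoin_le_iff]
    rintro x (⟨k, rfl⟩ | ⟨k, rfl⟩)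
    · fin_cases k
      · exact ha i
      · exact ha j
    · fin_cases k
      · exact hF'mem _ (halg i)
      · exact hF'mem _ (halg j)
  have h2 : Algebra.trdeg ℚ E ≤ Algebra.trdeg ℚ F' :=
    trdeg_le_of_injective (A' := F') (IntermediateField.inclusion hle)
      (IntermediateField.inclusion_injective hle)
  have h3 : Algebra.trdeg ℚ F' = Algebra.trdeg ℚ F := by
    have : Algebra.IsAlgebraic F F' := algebraicClosure.isAlgebraic F ℂ
    exact trdeg_eq_of_isAlgebraic ℚ F F'
  rw [← h3]
  exact_mod_cast h1.trans h2

end Transcendence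

/-! ### Solutions near multiples of a lattice point, and their asymptotics -/

section Solutions

variable {n : ℕ}

theorem tendsto_log_norm_of_hasDegree {U : Set (Fin n → ℂ)} {f h : (Fin n → ℂ) → ℂ} {r : ℚ}
    (hhom : IsHomogeneousFunction U h r) {y : Fin n → ℂ} (hyU : y ∈ U) (hy : h y ≠ 0)
    (hfh : (fun t : ℝ => f (t • y) - h (t • y)) =o[atTop] fun t : ℝ => t ^ (r : ℝ)) :
    Tendsto (fun N : ℕ => Real.log ‖f ((N : ℝ) • y)‖ / Real.log N) atTop (𝓝 (r : ℝ)) := by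
  refine (tendsto_log_norm_div_log (norm_pos_iff.mpr hy) ?_).2
  have h1 : Tendsto (fun t : ℝ => (f (t • y) - h (t • y)) / ((t ^ (r : ℝ) : ℝ) : ℂ)) atTop (𝓝 0) := by
    rw [tendsto_zero_iff_norm_tendsto_zero]
    refine hfh.norm_norm.tendsto_div_nhds_zero.congr fun t => ?_
    rw [norm_div, Complex.norm_real]
  have h2 := ((h1.add_const (h y)).norm).comp (tendsto_natCast_atTop_atTop (R := ℝ))
  rw [zero_add] at h2
  refine h2.congr' ?_
  filter_upwards [eventually_ge_atTop 1] with N hN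
  have hN1 : (1 : ℝ) ≤ N := by exact_mod_cast hN
  have hpos : (0 : ℝ) < (N : ℝ) ^ (r : ℝ) := Real.rpow_pos_of_pos (by linarith) _
  have hpos' : (((N : ℝ) ^ (r : ℝ) : ℝ) : ℂ) ≠ 0 := by exact_mod_cast hpos.ne'
  rw [Function.comp_apply, hhom y hyU N hN1, sub_div, mul_div_cancel_left₀ _ hpos', sub_add_cancel,
    norm_div, Complex.norm_real, Real.norm_of_nonneg hpos.le]

theorem exp_natCast_smul_lattice {y : Fin n → ℂ} (hy : y ∈ lattice n) (N : ℕ) (i : Fin n) :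
    Complex.exp (((N : ℝ) • y) i) = 1 := by
  obtain ⟨k, -, hk⟩ := hy i
  rw [Pi.smul_apply, hk, Complex.exp_eq_one_iff]
  exact ⟨N * k, by push_cast [Complex.real_smul]; ring⟩

/-- Since `(log N) ^ 2 = o(N)`, a ball of radius `δ N` is eventually large enough for
`exists_exp_eq_near` with `M log N` in place of `M`. -/
theorem eventually_sq_log_le {M δ : ℝ} (hM : 0 < M) (hδ : 0 < δ) :
    ∀ᶠ N : ℕ in atTop,
      16 * (M * Real.log N + 1) * (M * Real.log N + 5) ≤ δ * N := by
  have h1 := (Real.isLittleO_pow_log_id_atTop (n := 2)).def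
    (c := δ / (16 * (M + 5) ^ 2)) (by positivity)
  filter_upwards [tendsto_natCast_atTop_atTop.eventually h1,
    tendsto_log_natCast.eventually_ge_atTop 1] with N h2 h3
  simp only [id, Real.norm_eq_abs, abs_of_nonneg (sq_nonneg (Real.log (N : ℝ))), Nat.abs_cast] at h2
  rw [div_mul_eq_mul_div, le_div_iff₀ (by positivity)] at h2
  refine le_trans ?_ h2
  have h4 : M * Real.log N + 5 ≤ (M + 5) * Real.log N := by nlinarith
  have h5 : 0 ≤ M * Real.log N := by positivity
  calc 16 * (M * Real.log N + 1) * (M * Real.log N + 5)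
      ≤ 16 * ((M + 5) * Real.log N) * ((M + 5) * Real.log N) := by gcongr; linarith
    _ = _ := by ring

/-- The ball of radius `δ N` around `N y` is the `N`-fold dilate of a fixed ball around `y`, where
the growth bounds hold uniformly. The set `G` carries any further condition that holds on a conical
neighbourhood of the ray. -/
theorem eventually_exists_solution {U : Set (Fin n → ℂ)} (hU : IsCone U)
    {f : Fin n → (Fin n → ℂ) → ℂ} (hf : ∀ i, AnalyticOnNhd ℂ (f i) U) {y : Fin n → ℂ}
    (hyU : y ∈ U) (hy : y ∈ lattice n) {M : ℝ} (hM : 0 < M)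
    (hgrow : ∀ i, ∀ᶠ q : ℝ × (Fin n → ℂ) in atTop ×ˢ 𝓝 y,
      f i (q.1 • q.2) ≠ 0 ∧ |Real.log ‖f i (q.1 • q.2)‖| ≤ M * Real.log q.1)
    {G : Set (Fin n → ℂ)} (hG : ∀ᶠ q : ℝ × (Fin n → ℂ) in atTop ×ˢ 𝓝 y, q.1 • q.2 ∈ G) :
    ∀ᶠ N : ℕ in atTop, ∃ a ∈ U, a ∈ G ∧ ‖a - (N : ℝ) • y‖ ≤ M * Real.log N + 5 ∧
      ∀ i, Complex.exp (a i) = f i a ∧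
        |Real.log ‖f i a‖ - Real.log ‖f i ((N : ℝ) • y)‖| ≤ 1 := by
  have hyU' : ∀ᶠ w in 𝓝 y, w ∈ U := hU.1.mem_nhds hyU
  have hall := ((eventually_all.mpr hgrow).and hG).and
    ((eventually_ge_atTop (1 : ℝ)).prod_mk hyU')
  obtain ⟨pa, hpa, pb, hpb, hab⟩ := eventually_prod_iff.mp hall
  obtain ⟨δ, hδ, hball⟩ := Metric.eventually_nhds_iff_ball.mp hpb
  filter_upwards [tendsto_natCast_atTop_atTop.eventually hpa, eventually_sq_log_le hM hδ,
    eventually_gt_atTop 1] with N hNa hNsq hN1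
  have hN1' : (1 : ℝ) < N := by exact_mod_cast hN1
  have hlog := Real.log_pos hN1'
  have hpt : ∀ z ∈ Metric.ball ((N : ℝ) • y) (δ * N),
      ((∀ i, f i z ≠ 0 ∧ |Real.log ‖f i z‖| ≤ M * Real.log N) ∧ z ∈ G) ∧ z ∈ U := by
    intro z hz
    have hw : (N : ℝ)⁻¹ • z ∈ Metric.ball y δ := by
      rw [Metric.mem_ball, dist_eq_norm] at hz ⊢
      have : (N : ℝ)⁻¹ • z - y = (N : ℝ)⁻¹ • (z - (N : ℝ) • y) := by
        rw [smul_sub, smul_smul, inv_mul_cancel₀ (by linarith), one_smul]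
      rw [this, norm_smul, norm_inv, Real.norm_of_nonneg (by linarith),
        inv_mul_lt_iff₀ (by linarith)]
      linarith
    have h1 := hab hNa (hball _ hw)
    have h2 : (N : ℝ) • (N : ℝ)⁻¹ • z = z := smul_inv_smul₀ (by linarith) z
    have h3 := hU.2 N hN1'.le _ h1.2.2
    simp only [h2] at h1 h3
    exact ⟨h1.1, h3⟩
  obtain ⟨a, ha, hsol⟩ := exists_exp_eq_near (f := f) (w := (N : ℝ) • y) (R := δ * N)
    (M := M * Real.log N) (by positivity) hNsq
    (fun i z hz => ((hf i) z (hpt z hz).2).differentiableAt.differentiableWithinAt)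
    (fun i z hz => ((hpt z hz).1.1 i).1) (fun i z hz => ((hpt z hz).1.1 i).2)
    (exp_natCast_smul_lattice hy N)
  have haball : a ∈ Metric.ball ((N : ℝ) • y) (δ * N) := by
    rw [Metric.mem_ball, dist_eq_norm]
    have : 0 < M * Real.log N := by positivity
    nlinarith
  exact ⟨a, (hpt a haball).2, (hpt a haball).1.2, ha, hsol⟩

/-- If solutions near `N y` have rationally dependent coordinates `i`, `j`, then the growth
exponents of `f i` and `f j` along `y` are proportional to the coordinates of `y`. -/
theorem tendsto_exponent_of_dependent {f : Fin n → (Fin n → ℂ) → ℂ} {y : Fin n → ℂ} {i j : Fin n}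
    {ki kj : ℤ} (hki : ki ≠ 0) (hyi : y i = 2 * (Real.pi : ℂ) * Complex.I * (ki : ℂ))
    (hyj : y j = 2 * (Real.pi : ℂ) * Complex.I * (kj : ℂ)) {M r : ℝ} {a : ℕ → Fin n → ℂ}
    (ha : ∀ᶠ N : ℕ in atTop, ‖a N - (N : ℝ) • y‖ ≤ M * Real.log N + 5)
    (hsol : ∀ᶠ N : ℕ in atTop, ∀ i, Complex.exp (a N i) = f i (a N) ∧
        |Real.log ‖f i (a N)‖ - Real.log ‖f i ((N : ℝ) • y)‖| ≤ 1)
    (hdep : ∀ᶠ N : ℕ in atTop, ¬ LinearIndependent ℚ ![a N i, a N j])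
    (hr : Tendsto (fun N : ℕ => Real.log ‖f i ((N : ℝ) • y)‖ / Real.log N) atTop (𝓝 r)) :
    Tendsto (fun N : ℕ => Real.log ‖f j ((N : ℝ) • y)‖ / Real.log N) atTop
      (𝓝 (kj / ki * r)) := by
  have hpi := Real.pi_pos
  have hlogN : Tendsto (fun N : ℕ => Real.log (N : ℝ) / N) atTop (𝓝 0) := by
    have := (Real.isLittleO_log_id_atTop.tendsto_div_nhds_zero).comp
      (tendsto_natCast_atTop_atTop (R := ℝ))
    exact this
  have hrate : Tendsto (fun N : ℕ => (M * Real.log N + 5) / N) atTop (𝓝 0) := by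
    have := (hlogN.const_mul M).add (tendsto_const_div_atTop_nhds_zero_nat (5 : ℝ))
    rw [mul_zero, zero_add] at this
    refine this.congr fun N => ?_
    ring
  -- the imaginary parts of the coordinates
  have him : ∀ l : Fin n, ∀ k : ℤ, y l = 2 * (Real.pi : ℂ) * Complex.I * (k : ℂ) →
      Tendsto (fun N : ℕ => (a N l).im / N) atTop (𝓝 (2 * Real.pi * k)) := by
    intro l k hl
    have hyim : (y l).im = 2 * Real.pi * k := by
      rw [hl]; simp
    rw [← hyim, tendsto_iff_norm_sub_tendsto_zero]
    refine squeeze_zero' (Eventually.of_forall fun _ => norm_nonneg _) ?_ hrate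
    filter_upwards [ha, eventually_gt_atTop 0] with N hN hN0
    have hN0' : (0 : ℝ) < N := by exact_mod_cast hN0
    have h1 : (a N l).im / N - (y l).im = ((a N - (N : ℝ) • y) l).im / N := by
      rw [Pi.sub_apply, Pi.smul_apply, Complex.sub_im, Complex.real_smul, Complex.im_ofReal_mul]
      field_simp
    rw [h1, norm_div, Real.norm_of_nonneg hN0'.le]
    gcongr
    exact (Complex.abs_im_le_norm _).trans ((norm_le_pi_norm _ l).trans hN)
  have himi := him i ki hyi
  have himj := him j kj hyj
  have hlim0 : 2 * Real.pi * (ki : ℝ) ≠ 0 := by positivity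
  have hai0 : ∀ᶠ N : ℕ in atTop, (a N i).im / N ≠ 0 := himi.eventually_ne hlim0
  have hq : ∀ᶠ N : ℕ in atTop, ∃ q : ℚ, a N j = (q : ℝ) * a N i := by
    filter_upwards [hai0, hdep] with N h1 h2
    have h3 : a N i ≠ 0 := by
      intro h; simp [h] at h1
    rw [LinearIndependent.pair_iff' h3] at h2
    push Not at h2
    obtain ⟨q, hq⟩ := h2
    exact ⟨q, by rw [← hq, Rat.smul_def]; simp⟩
  -- The ratio `q N` is real, so `a N j = q N * a N i` holds separately for real and imaginary
  -- parts.
  obtain ⟨q, hq⟩ := hq.choice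
  have hqlim : Tendsto (fun N => ((q N : ℚ) : ℝ)) atTop (𝓝 (kj / ki)) := by
    have h1 := himj.div himi hlim0
    have h2 : 2 * Real.pi * (kj : ℝ) / (2 * Real.pi * ki) = kj / ki := by
      field_simp
    rw [h2] at h1
    refine h1.congr' ?_
    filter_upwards [hq, hai0] with N h3 h4
    rw [Pi.div_apply, div_eq_iff h4, h3, Complex.im_ofReal_mul]
    ring
  -- the real parts of the coordinates
  have hre : ∀ l : Fin n, Tendsto (fun N : ℕ => ((a N l).re - Real.log ‖f l ((N : ℝ) • y)‖) /
      Real.log N) atTop (𝓝 0) := by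
    intro l
    rw [tendsto_zero_iff_norm_tendsto_zero]
    refine squeeze_zero' (Eventually.of_forall fun _ => norm_nonneg _) ?_
      (tendsto_log_natCast.const_div_atTop 1)
    filter_upwards [hsol, eventually_gt_atTop 1] with N hN hN1
    have hlog : 0 < Real.log N := Real.log_pos (by exact_mod_cast hN1)
    have h1 : (a N l).re = Real.log ‖f l (a N)‖ := by
      rw [← (hN l).1, Complex.norm_exp, Real.log_exp]
    rw [norm_div, Real.norm_of_nonneg hlog.le, h1]
    gcongr
    exact (hN l).2
  have hrei : Tendsto (fun N : ℕ => (a N i).re / Real.log N) atTop (𝓝 r) := by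
    have := (hre i).add hr
    rw [zero_add] at this
    refine this.congr fun N => ?_
    ring
  have hfinal := (hqlim.mul hrei).sub (hre j)
  rw [sub_zero] at hfinal
  refine hfinal.congr' ?_
  filter_upwards [hq] with N hN
  rw [hN, Complex.re_ofReal_mul]
  ring

theorem homogeneousComponent_totalDegree_ne_zero {K : Type} [Field K] {p : MvPolynomial (Fin n) K}
    (hp : p ≠ 0) : MvPolynomial.homogeneousComponent p.totalDegree p ≠ 0 := by
  obtain ⟨d, hd, hdeg⟩ := Finset.exists_mem_eq_sup p.support
    (MvPolynomial.support_nonempty.mpr hp) fun s => s.sum fun _ e => e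
  intro h
  have h1 := MvPolynomial.coeff_homogeneousComponent p.totalDegree p d
  rw [h, MvPolynomial.coeff_zero, if_pos (by rw [MvPolynomial.totalDegree, hdeg]; rfl)] at h1
  exact MvPolynomial.mem_support_iff.mp hd h1.symm

end Solutions

end ExpAlg

/-! ### Choice of a generic lattice point and conclusion -/

open Filter Topology in
theorem mainTheorem7 (hSC : ExpAlg.SchanuelConjecture) (n : ℕ) (hn : 2 ≤ n)
    (U : Set (Fin n → ℂ)) (hU : ExpAlg.IsCone U)
    (hdense : ExpAlg.IsZariskiDense (U ∩ ExpAlg.lattice n))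
    (f : Fin n → (Fin n → ℂ) → ℂ)
    (halg : ∀ i, ExpAlg.IsAlgebraicFunction ℚ U (f i))
    (hnz : ∀ i, ExpAlg.NonzeroOn U (f i))
    (hdeg : ∃ r : ℚ, r ≠ 0 ∧ ExpAlg.HasDegree U (f ⟨0, by omega⟩) r) :
    ∃ a ∈ U, (∀ i, Complex.exp (a i) = f i a) ∧
      2 ≤ Algebra.trdeg ℚ (IntermediateField.adjoin ℚ (Set.range a)) := by
  obtain ⟨r, hr0, h, hhalg, hhnz, hhom, hfh⟩ := hdeg
  set i0 : Fin n := ⟨0, by omega⟩ with hi0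
  set i1 : Fin n := ⟨1, by omega⟩ with hi1
  have hi01 : i0 ≠ i1 := by simp [hi0, hi1]
  choose p hp0 hp using fun i => ExpAlg.exists_coeff_zero_ne_zero hU.1 (halg i) (hnz i)
  obtain ⟨q, hq0, hq⟩ := ExpAlg.exists_coeff_zero_ne_zero hU.1 hhalg hhnz
  have hplead : ∀ i, (p i).leadingCoeff ≠ 0 := fun i =>
    Polynomial.leadingCoeff_ne_zero.mpr fun h => hp0 i (by rw [h, Polynomial.coeff_zero])
  set S := ExpAlg.slopes (p i1).natDegree
    (∑ j ∈ Finset.range ((p i1).natDegree + 1), ((p i1).coeff j).totalDegree) with hS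
  set T : MvPolynomial (Fin n) ℚ → MvPolynomial (Fin n) ℂ := fun P =>
    MvPolynomial.map (algebraMap ℚ ℂ) (MvPolynomial.homogeneousComponent P.totalDegree P) with hT
  have hT0 : ∀ P, P ≠ 0 → T P ≠ 0 := by
    intro P hP h
    apply ExpAlg.homogeneousComponent_totalDegree_ne_zero hP
    apply MvPolynomial.map_injective (σ := Fin n) _ (algebraMap ℚ ℂ).injective
    rw [map_zero]
    exact h
  -- The top forms of the constant and leading coefficients give the growth bounds, `q.coeff 0`
  -- gives `h y ≠ 0`, and the linear forms exclude `(y i1 / y i0) * r ∈ S`.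
  set Q : MvPolynomial (Fin n) ℂ := ((∏ i, T ((p i).coeff 0) * T (p i).leadingCoeff) * q.coeff 0) *
    ∏ σ ∈ S, (MvPolynomial.C (r : ℂ) * MvPolynomial.X i1 -
      MvPolynomial.C (σ : ℂ) * MvPolynomial.X i0) with hQ
  have hQ0 : Q ≠ 0 := by
    refine mul_ne_zero (mul_ne_zero (Finset.prod_ne_zero_iff.mpr fun i _ =>
      mul_ne_zero (hT0 _ (hp0 i)) (hT0 _ (hplead i))) hq0) (Finset.prod_ne_zero_iff.mpr fun σ _ hσ => ?_)
    -- At this basis vector the linear form takes the value `r`; this is where `r ≠ 0` enters.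
    have h1 := congrArg (MvPolynomial.eval (Pi.single i1 (1 : ℂ))) hσ
    simp [hi01] at h1
    exact hr0 h1
  obtain ⟨y, ⟨hyU, hyl⟩, hyQ⟩ : ∃ y ∈ U ∩ ExpAlg.lattice n, MvPolynomial.eval y Q ≠ 0 := by
    by_contra hcon
    push Not at hcon
    exact hQ0 (hdense Q hcon)
  rw [hQ, map_mul, map_mul, map_prod, map_prod] at hyQ
  obtain ⟨hy12, hyS⟩ := mul_ne_zero_iff.mp hyQ
  obtain ⟨hyT, hyq⟩ := mul_ne_zero_iff.mp hy12
  have hevT : ∀ P, MvPolynomial.eval y (T P) =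
      MvPolynomial.aeval y (MvPolynomial.homogeneousComponent P.totalDegree P) := by
    intro P
    rw [hT, MvPolynomial.eval_map]; rfl
  have hyT' : ∀ i, MvPolynomial.eval y (T ((p i).coeff 0)) ≠ 0 ∧
      MvPolynomial.eval y (T (p i).leadingCoeff) ≠ 0 := by
    intro i
    have := Finset.prod_ne_zero_iff.mp hyT i (Finset.mem_univ i)
    rw [map_mul] at this
    exact mul_ne_zero_iff.mp this
  simp only [hevT] at hyT'
  have hhy : h y ≠ 0 := by
    intro h0
    have h1 := hq y hyU
    rw [h0, Polynomial.eval₂_at_zero] at h1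
    exact hyq h1
  -- growth of the functions near the ray through `y`
  choose M hM hgrow using fun i =>
    ExpAlg.eventually_abs_log_norm_le hU (hp i) hyU (hyT' i).1 (hyT' i).2
  set M' := ∑ i, M i with hM'
  have hMle : ∀ i, M i ≤ M' := fun i =>
    Finset.single_le_sum (fun j _ => (hM j).le) (Finset.mem_univ i)
  have hM'pos : 0 < M' := (hM i0).trans_le (hMle i0)
  have hgrow' : ∀ i, ∀ᶠ q : ℝ × (Fin n → ℂ) in atTop ×ˢ 𝓝 y,
      f i (q.1 • q.2) ≠ 0 ∧ |Real.log ‖f i (q.1 • q.2)‖| ≤ M' * Real.log q.1 := by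
    intro i
    filter_upwards [hgrow i, (eventually_ge_atTop (1 : ℝ)).prod_inl _] with q h1 h2
    refine ⟨h1.1, h1.2.trans ?_⟩
    gcongr
    · exact Real.log_nonneg h2
    · exact hMle i
  -- Needed at the solution `a` itself, so that each `f i a` is algebraic over `ℚ(a)`.
  have hgood : ∀ᶠ q : ℝ × (Fin n → ℂ) in atTop ×ˢ 𝓝 y,
      q.1 • q.2 ∈ {a : Fin n → ℂ | ∀ i, MvPolynomial.aeval a ((p i).coeff 0) ≠ (0 : ℂ)} := by
    refine eventually_all.mpr fun i => ?_
    obtain ⟨c, hc, hlow⟩ := ExpAlg.eventually_le_norm_aeval_smul _ y (hyT' i).1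
    filter_upwards [hlow] with q hq
    exact norm_pos_iff.mp (hc.trans_le hq)
  have hsol := ExpAlg.eventually_exists_solution hU (fun i => (halg i).1) hyU hyl hM'pos hgrow' hgood
  by_contra hcon
  push Not at hcon
  obtain ⟨a, ha⟩ := hsol.choice
  have hdep : ∀ᶠ N : ℕ in atTop, ¬ LinearIndependent ℚ ![a N i0, a N i1] := by
    filter_upwards [ha] with N hN hli
    refine absurd (ExpAlg.two_le_trdeg_adjoin hSC hli fun i => ?_)
      (not_le.mpr (hcon (a N) hN.1 fun i => (hN.2.2.2 i).1))
    rw [(hN.2.2.2 i).1]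
    exact ExpAlg.isAlgebraic_adjoin_of_eval₂_eq_zero (hN.2.1 i) (hp i _ hN.1)
  obtain ⟨k0, hk0, hyk0⟩ := hyl i0
  obtain ⟨k1, -, hyk1⟩ := hyl i1
  have hexp := ExpAlg.tendsto_exponent_of_dependent hk0 hyk0 hyk1 (ha.mono fun N hN => hN.2.2.1)
    (ha.mono fun N hN => hN.2.2.2) hdep
    (ExpAlg.tendsto_log_norm_of_hasDegree hhom hyU hhy (hfh y hyU))
  have hne : ∀ᶠ N : ℕ in atTop, f i1 ((N : ℝ) • y) ≠ 0 := by
    have h1 : ∀ᶠ t : ℝ in atTop, f i1 (t • y) ≠ 0 :=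
      (hgrow i1).curry.mono fun t ht => ht.self_of_nhds.1
    exact tendsto_natCast_atTop_atTop.eventually h1
  -- No degree is assumed for `f i1`: the dependence of the coordinates has produced its exponent
  -- along `y`, which must now be one of the excluded slopes.
  obtain ⟨σ, hσS, hσ⟩ := ExpAlg.exponent_mem_slopes hU (hp i1) hyU (hyT' i1).1 hne hexp
  refine Finset.prod_ne_zero_iff.mp hyS σ hσS ?_
  have hk0' : (k0 : ℝ) ≠ 0 := by exact_mod_cast hk0
  have h1 : (k1 : ℝ) * r = σ * k0 := by
    rw [← hσ]; field_simp
  have h2 : (k1 : ℂ) * r = σ * k0 := by exact_mod_cast h1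
  simp only [map_sub, map_mul, MvPolynomial.eval_C, MvPolynomial.eval_X, hyk0, hyk1]
  linear_combination 2 * (Real.pi : ℂ) * Complex.I * h2
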